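/- Let $K,T\ge 1$ be integers and let $G$ be an undirected graph on the set of arms $[K]$ (all self-loops are understood to be included), with independence number $\alpha$. Let $P$ be a probability distribution on $[0,1]^K$. In each round $t=1,\dots,T$ a learner chooses an arm $a_t\in[K]$, a reward vector $X_t=(X_{t,a})_{a\in[K]}$ is drawn from $P$, independently of $a_t$ and of everything that happened in earlier rounds, the learner collects $X_{t,a_t}$, and it observes $X_{t,a}$ for $a=a_t$ and for every neighbour $a$ of $a_t$ in $G$. The algorithm UCB-N with confidence parameter $\delta$ chooses in each round $t$ an arm that maximizes the index $$\hat\mu_a^t+\sqrt{\frac{c\,\log(2TK/\delta)}{N_a^t}},$$ where $N_a^t$ is the number of rounds before $t$ in which arm $a$ was observed, $\hat\mu_a^t$ is the average of the rewards of $a$ observed in these rounds, the index is $+\infty$ if $N_a^t=0$, and $c\in[\tfrac12,2]$ is a fixed constant. Ties are broken arbitrarily, possibly at random, but without knowledge of the current or future rewards. Then, with $\delta=1/T$, the expected regret (pseudo-regret) of UCB-N satisfies $$\max_{a\in[K]}\mathbb{E}\left[\sum_{t=1}^T X_{t,a}-\sum_{t=1}^T X_{t,a_t}\right]\;\le\;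 2+4\sqrt{2\,\alpha\,T\,\log(2KT^2)\,\bigl(\log_2\alpha+3\bigr)},$$ where $\log$ is the natural logarithm. -/

import Mathlib

open MeasureTheory ProbabilityTheory

/-- Arm `b` is observed when arm `a` is pulled: `b` is `a` itself (every vertex of the feedback
graph carries a self-loop) or a neighbour of `a`. -/
def Observes {K : ℕ} (G : SimpleGraph (Fin K)) (a b : Fin K) : Prop :=
  a = b ∨ G.Adj a b

open Classical in
/-- The rounds before round `t` in which arm `b` was observed, when the arms pulled are
`a 0, a 1, …` (rounds are numbered from `0`). -/
noncomputable def obsTimes {K : ℕ} (G : SimpleGraph (Fin K)) (a : ℕ → Fin K) (t : ℕ)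
    (b : Fin K) : Finset ℕ :=
  (Finset.range t).filter (fun s => Observes G (a s) b)

/-- The number of observations of arm `b` before round `t`. -/
noncomputable def obsCount {K : ℕ} (G : SimpleGraph (Fin K)) (a : ℕ → Fin K) (t : ℕ)
    (b : Fin K) : ℕ :=
  (obsTimes G a t b).card

/-- The empirical mean of the rewards of arm `b` observed before round `t`. -/
noncomputable def empMean {K : ℕ} (G : SimpleGraph (Fin K)) (x : ℕ → Fin K → ℝ)
    (a : ℕ → Fin K) (t : ℕ) (b : Fin K) : ℝ :=
  (∑ s ∈ obsTimes G a t b, x s b) / (obsCount G a t b : ℝ)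

open Classical in
/-- The upper confidence index of arm `b` at the start of round `t`, for horizon `T`, confidence
parameter `δ` and exploration constant `c`: it is `+∞` while `b` has never been observed, and
afterwards the empirical mean plus `√(c log (2TK/δ) / N)`, with `N` the number of observations. -/
noncomputable def ucbIndex {K : ℕ} (G : SimpleGraph (Fin K)) (T : ℕ) (δ c : ℝ)
    (x : ℕ → Fin K → ℝ) (a : ℕ → Fin K) (t : ℕ) (b : Fin K) : EReal :=
  if obsCount G a t b = 0 then ⊤
  else ((empMean G x a t b +
    Real.sqrt (c * Real.log (2 * (T : ℝ) * (K : ℝ) / δ) / (obsCount G a t b : ℝ)) : ℝ) : EReal)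

/-- The arms `a 0, …, a (T-1)` are choices of UCB-N on the reward sequence `x`: in every round an
arm with the largest index is pulled. Ties may be broken in any way. -/
def IsUCBNRun {K : ℕ} (G : SimpleGraph (Fin K)) (T : ℕ) (δ c : ℝ)
    (x : ℕ → Fin K → ℝ) (a : ℕ → Fin K) : Prop :=
  ∀ t < T, ∀ b : Fin K, ucbIndex G T δ c x a t b ≤ ucbIndex G T δ c x a t (a t)

/-- The stochastic protocol. The reward vectors `X 0, X 1, …` are drawn independently from `P`,
and the arm `A t` is chosen before `X t` is drawn. Here `ℱ t` is the information available at the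
start of round `t`; it contains the past rewards and possibly internal randomness of the learner,
and it is independent of `X t`. -/
structure IsStochasticRun {K : ℕ} {Ω : Type*} {mΩ : MeasurableSpace Ω} (μ : Measure Ω)
    (P : Measure (Fin K → ℝ)) (ℱ : Filtration ℕ mΩ) (X : ℕ → Ω → Fin K → ℝ)
    (A : ℕ → Ω → Fin K) : Prop where
  reward_measurable : ∀ t, Measurable[ℱ (t + 1)] (X t)
  arm_measurable : ∀ t, Measurable[ℱ t] (A t)
  reward_law : ∀ t, μ.map (X t) = P
  reward_indep : ∀ t, Indep (MeasurableSpace.comap (X t) inferInstance) (ℱ t) μ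

/-- The pseudo-regret `max_a 𝔼[∑_t X_{t,a} - ∑_t X_{t,a_t}]` over `T` rounds. -/
noncomputable def pseudoRegret {K : ℕ} {Ω : Type*} {mΩ : MeasurableSpace Ω} (μ : Measure Ω)
    (T : ℕ) (X : ℕ → Ω → Fin K → ℝ) (A : ℕ → Ω → Fin K) : ℝ :=
  ⨆ a : Fin K, ∫ ω, (∑ t ∈ Finset.range T, X t ω a -
    ∑ t ∈ Finset.range T, X t ω (A t ω)) ∂μ

/-- A finite family of reals whose superlevel sets `{d ≥ ε}` have at most `B / ε ^ 2` elements has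
sum at most `2 √(B n)`, where `n` is the size of the family. -/
theorem sum_le_two_mul_sqrt_of_card_le {ι : Type*} [DecidableEq ι] (d : ι → ℝ) {B : ℝ}
    (hB : 0 ≤ B) (S : Finset ι)
    (h : ∀ ε : ℝ, 0 < ε → ((S.filter (fun i => ε ≤ d i)).card : ℝ) * ε ^ 2 ≤ B) :
    ∑ i ∈ S, d i ≤ 2 * Real.sqrt (B * S.card) := by
  induction hn : S.card generalizing S with
  | zero =>
    rw [Finset.card_eq_zero] at hn
    simp [hn]
  | succ n ih =>
    have hne : S.Nonempty := Finset.card_pos.mp (by omega)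
    obtain ⟨i, hi, hmin⟩ := S.exists_min_image d hne
    have hcard : (S.erase i).card = n := by rw [Finset.card_erase_of_mem hi, hn]; simp
    have h1 := ih (S.erase i) (fun ε hε => by
      refine le_trans ?_ (h ε hε)
      gcongr
      exact Finset.erase_subset _ _) hcard
    rw [← Finset.add_sum_erase S d hi]
    have hsq1 := Real.sq_sqrt (show (0 : ℝ) ≤ B * n by positivity)
    have hsq2 := Real.sq_sqrt (show (0 : ℝ) ≤ B * (n + 1 : ℕ) by positivity)
    have hle : Real.sqrt (B * n) ≤ Real.sqrt (B * (n + 1 : ℕ)) :=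
      Real.sqrt_le_sqrt (by push_cast; nlinarith)
    have hp := Real.sqrt_nonneg (B * n)
    set p := Real.sqrt (B * n)
    set q := Real.sqrt (B * (n + 1 : ℕ))
    push_cast at hsq2
    rcases le_or_gt (d i) 0 with hd | hd
    · linarith
    · have h2 := h (d i) hd
      rw [Finset.filter_true_of_mem hmin, hn] at h2
      push_cast at h2
      have hBpos : 0 < B := lt_of_lt_of_le (by positivity) h2
      have hq : 0 < q := by
        rcases (hp.trans hle).lt_or_eq with h | h
        · exact h
        · rw [← h] at hsq2; nlinarith
      have hdq : d i * q ≤ B := by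
        have : (d i * q) ^ 2 ≤ B ^ 2 := by
          rw [mul_pow, hsq2]; nlinarith
        exact abs_le_of_sq_le_sq' this hB |>.2
      have h3 : q * (d i) ≤ q * (2 * (q - p)) := by nlinarith
      have := le_of_mul_le_mul_left h3 hq
      linarith

/-- The greedy choice, in increasing order, of a subset of times whose arms do not observe each
other dominates all remaining times. -/
theorem exists_greedy_nonobserving {K : ℕ} (G : SimpleGraph (Fin K)) (a : ℕ → Fin K)
    (S : Finset ℕ) :
    ∃ I ⊆ S, (∀ s ∈ I, ∀ t ∈ I, s < t → ¬ Observes G (a s) (a t)) ∧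
      ∀ t ∈ S, t ∉ I → ∃ s ∈ I, s < t ∧ Observes G (a s) (a t) := by
  classical
  induction S using Finset.induction_on_max with
  | empty => exact ⟨∅, by simp⟩
  | insert m S hm ih =>
    obtain ⟨I, hIS, hind, hdom⟩ := ih
    by_cases hex : ∃ s ∈ I, Observes G (a s) (a m)
    · obtain ⟨s, hs, hobs⟩ := hex
      refine ⟨I, hIS.trans (Finset.subset_insert _ _), hind, fun t ht htI => ?_⟩
      rcases Finset.mem_insert.mp ht with rfl | ht
      · exact ⟨s, hs, hm s (hIS hs), hobs⟩
      · exact hdom t ht htI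
    · push Not at hex
      refine ⟨insert m I, Finset.insert_subset_insert _ hIS, ?_, fun t ht htI => ?_⟩
      · intro s hs t ht hst
        rcases Finset.mem_insert.mp hs with rfl | hsI
        · rcases Finset.mem_insert.mp ht with rfl | htI
          · exact absurd hst (lt_irrefl _)
          · exact absurd hst (hm t (hIS htI)).not_gt
        · rcases Finset.mem_insert.mp ht with rfl | htI
          · exact hex s hsI
          · exact hind s hsI t htI hst
      · rw [Finset.mem_insert, not_or] at htI
        rcases Finset.mem_insert.mp ht with rfl | ht
        · exact absurd rfl htI.1
        · obtain ⟨s, hs, h⟩ := hdom t ht htI.2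
          exact ⟨s, Finset.mem_insert_of_mem hs, h⟩

theorem card_le_indepNum_of_nonobserving {K : ℕ} (G : SimpleGraph (Fin K)) (a : ℕ → Fin K)
    (I : Finset ℕ) (h : ∀ s ∈ I, ∀ t ∈ I, s < t → ¬ Observes G (a s) (a t)) :
    I.card ≤ G.indepNum := by
  classical
  have hinj : Set.InjOn a I := by
    intro s hs t ht hst
    rcases lt_trichotomy s t with hlt | heq | hlt
    · exact absurd (Or.inl hst) (h s hs t ht hlt)
    · exact heq
    · exact absurd (Or.inl hst.symm) (h t ht s hs hlt)
  rw [← Finset.card_image_of_injOn hinj]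
  refine SimpleGraph.IsIndepSet.card_le_indepNum (G := G) ?_
  rw [SimpleGraph.isIndepSet_iff]
  intro x hx y hy hxy hadj
  simp only [Finset.coe_image, Set.mem_image, Finset.mem_coe] at hx hy
  obtain ⟨s, hs, rfl⟩ := hx
  obtain ⟨t, ht, rfl⟩ := hy
  rcases lt_trichotomy s t with hlt | heq | hlt
  · exact h s hs t ht hlt (Or.inr hadj)
  · exact hxy (by rw [heq])
  · exact h t ht s hs hlt (Or.inr hadj.symm)

open Classical in
/-- If each arm pulled at a time in `S` was observed at most `n` times earlier in `S`, then `S`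
splits into `n + 1` independent layers. -/
theorem card_le_indepNum_mul {K : ℕ} (G : SimpleGraph (Fin K)) (a : ℕ → Fin K) (n : ℕ)
    (S : Finset ℕ)
    (h : ∀ t ∈ S, (S.filter (fun s => s < t ∧ Observes G (a s) (a t))).card ≤ n) :
    S.card ≤ G.indepNum * (n + 1) := by
  induction n generalizing S with
  | zero =>
    rw [zero_add, mul_one]
    refine card_le_indepNum_of_nonobserving G a S fun s hs t ht hst hobs => ?_
    have := h t ht
    rw [Nat.le_zero, Finset.card_eq_zero] at this
    exact Finset.notMem_empty s (this ▸ Finset.mem_filter.mpr ⟨hs, hst, hobs⟩)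
  | succ n ih =>
    obtain ⟨I, hIS, hind, hdom⟩ := exists_greedy_nonobserving G a S
    have h1 := card_le_indepNum_of_nonobserving G a I hind
    have h2 := ih (S \ I) (fun t ht => by
      rw [Finset.mem_sdiff] at ht
      obtain ⟨s, hs, hst⟩ := hdom t ht.1 ht.2
      have hlt : ((S \ I).filter (fun s => s < t ∧ Observes G (a s) (a t))).card <
          (S.filter (fun s => s < t ∧ Observes G (a s) (a t))).card := by
        refine Finset.card_lt_card (Finset.ssubset_iff_subset_ne.mpr
          ⟨Finset.filter_subset_filter _ Finset.sdiff_subset, fun heq => ?_⟩)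
        have : s ∈ S.filter (fun s => s < t ∧ Observes G (a s) (a t)) :=
          Finset.mem_filter.mpr ⟨hIS hs, hst⟩
        rw [← heq, Finset.mem_filter, Finset.mem_sdiff] at this
        exact this.1.2 hs
      have := h t ht.1
      omega)
    have h3 := Finset.card_sdiff_add_card_eq_card hIS
    nlinarith

theorem card_le_indepNum_mul_of_obsCount_le {K : ℕ} (G : SimpleGraph (Fin K)) (a : ℕ → Fin K)
    (n : ℕ) (S : Finset ℕ) (h : ∀ t ∈ S, obsCount G a t (a t) ≤ n) :
    S.card ≤ G.indepNum * (n + 1) := by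
  classical
  refine card_le_indepNum_mul G a n S fun t ht => le_trans ?_ (h t ht)
  refine Finset.card_le_card fun s hs => ?_
  rw [Finset.mem_filter] at hs
  exact Finset.mem_filter.mpr ⟨Finset.mem_range.mpr hs.2.1, hs.2.2⟩

/-- If each pulled arm `b` had at most `C / gap b ^ 2` observations when it was pulled, then the
sum of the gaps over `T` rounds is at most `2 √(2 α C T)`. -/
theorem sum_gap_le_of_obsCount_le {K : ℕ} (G : SimpleGraph (Fin K)) (a : ℕ → Fin K) (T : ℕ)
    (gap : Fin K → ℝ) (hgap : ∀ b, gap b ≤ 1) {C : ℝ} (hC : 1 ≤ C)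
    (h : ∀ t < T, (obsCount G a t (a t) : ℝ) * gap (a t) ^ 2 ≤ C) :
    ∑ t ∈ Finset.range T, gap (a t) ≤ 2 * Real.sqrt (2 * G.indepNum * C * T) := by
  have key := sum_le_two_mul_sqrt_of_card_le (fun t => gap (a t))
    (B := 2 * G.indepNum * C) (by positivity) (Finset.range T) (fun ε hε => by
    set S := (Finset.range T).filter (fun t => ε ≤ gap (a t)) with hS
    rcases S.eq_empty_or_nonempty with hE | ⟨t₀, ht₀⟩
    · rw [hE]; simp; positivity
    have hε1 : ε ≤ 1 := (Finset.mem_filter.mp ht₀).2.trans (hgap _)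
    have hcard := card_le_indepNum_mul_of_obsCount_le G a ⌊C / ε ^ 2⌋₊ S (fun t ht => by
      obtain ⟨ht, hεt⟩ := Finset.mem_filter.mp ht
      refine Nat.le_floor ?_
      rw [le_div_iff₀ (by positivity)]
      refine le_trans ?_ (h t (Finset.mem_range.mp ht))
      gcongr)
    have hfl : (⌊C / ε ^ 2⌋₊ : ℝ) * ε ^ 2 ≤ C := by
      rw [← le_div_iff₀ (by positivity)]
      exact Nat.floor_le (by positivity)
    have hcard' : (S.card : ℝ) ≤ G.indepNum * (⌊C / ε ^ 2⌋₊ + 1) := by exact_mod_cast hcard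
    calc (S.card : ℝ) * ε ^ 2 ≤ G.indepNum * (⌊C / ε ^ 2⌋₊ + 1) * ε ^ 2 := by gcongr
      _ = G.indepNum * (⌊C / ε ^ 2⌋₊ * ε ^ 2 + ε ^ 2) := by ring
      _ ≤ G.indepNum * (C + C) := by gcongr; nlinarith
      _ = 2 * G.indepNum * C := by ring)
  simpa using key

open Classical in
/-- For predictable events `J s` and increments `Y s` that are independent of the past with
exponential moment `𝔼 exp (λ Y - λ² / 8) ≤ 1`, the exponential process sampled on `J` has mean at
most one. -/
theorem lintegral_prod_sampled_exp_le_one {Ω : Type*} {mΩ : MeasurableSpace Ω} {μ : Measure Ω}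
    [IsProbabilityMeasure μ] {ℱ : Filtration ℕ mΩ} {Y : ℕ → Ω → ℝ} {J : ℕ → Set Ω}
    (hY : ∀ s, Measurable[ℱ (s + 1)] (Y s)) (hJ : ∀ s, MeasurableSet[ℱ s] (J s))
    (hind : ∀ s, Indep (MeasurableSpace.comap (Y s) inferInstance) (ℱ s) μ) (r : ℝ)
    (hexp : ∀ s, ∫⁻ ω, ENNReal.ofReal (Real.exp (r * Y s ω - r ^ 2 / 8)) ∂μ ≤ 1) (T : ℕ) :
    (Measurable[ℱ T] fun ω => ∏ s ∈ Finset.range T,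
        if ω ∈ J s then ENNReal.ofReal (Real.exp (r * Y s ω - r ^ 2 / 8)) else 1) ∧
      ∫⁻ ω, ∏ s ∈ Finset.range T,
        (if ω ∈ J s then ENNReal.ofReal (Real.exp (r * Y s ω - r ^ 2 / 8)) else 1) ∂μ ≤ 1 := by
  set E : ℕ → Ω → ENNReal := fun s ω => ENNReal.ofReal (Real.exp (r * Y s ω - r ^ 2 / 8)) with hE
  have hmE : ∀ (m : MeasurableSpace Ω) s, Measurable[m] (Y s) → Measurable[m] (E s) :=
    fun m s h => by
      have : Measurable fun y : ℝ => ENNReal.ofReal (Real.exp (r * y - r ^ 2 / 8)) := by fun_prop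
      exact this.comp h
  induction T with
  | zero => simp
  | succ T ih =>
    obtain ⟨hm, hint⟩ := ih
    set Z : Ω → ENNReal := fun ω => ∏ s ∈ Finset.range T, if ω ∈ J s then E s ω else 1 with hZ
    have hle : ℱ T ≤ ℱ (T + 1) := ℱ.mono (Nat.le_succ T)
    simp_rw [Finset.prod_range_succ]
    constructor
    · exact (hm.mono hle le_rfl).mul
        (Measurable.ite (hle _ (hJ T)) (hmE _ T (hY T)) measurable_const)
    · have hsplit : ∀ ω, Z ω * (if ω ∈ J T then E T ω else 1) =
          (J T)ᶜ.indicator Z ω + (J T).indicator Z ω * E T ω := by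
        intro ω
        by_cases h : ω ∈ J T <;> simp [h]
      have hZ1 : Measurable[ℱ T] ((J T).indicator Z) := hm.indicator (hJ T)
      have hZ2 : Measurable[ℱ T] ((J T)ᶜ.indicator Z) := hm.indicator (hJ T).compl
      have hEY : Measurable[MeasurableSpace.comap (Y T) inferInstance] (E T) :=
        hmE _ T (comap_measurable (Y T))
      have hYT : Measurable (Y T) := (hY T).mono (ℱ.le _) le_rfl
      have hprod := lintegral_mul_eq_lintegral_mul_lintegral_of_independent_measurableSpace
        (ℱ.le T) hYT.comap_le (hind T).symm hZ1 hEY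
      calc ∫⁻ ω, Z ω * (if ω ∈ J T then E T ω else 1) ∂μ
          = ∫⁻ ω, (J T)ᶜ.indicator Z ω + (J T).indicator Z ω * E T ω ∂μ := by simp_rw [hsplit]
        _ = ∫⁻ ω, (J T)ᶜ.indicator Z ω ∂μ +
            (∫⁻ ω, (J T).indicator Z ω ∂μ) * ∫⁻ ω, E T ω ∂μ := by
          rw [lintegral_add_left (hZ2.mono (ℱ.le T) le_rfl), hprod]
        _ ≤ ∫⁻ ω, (J T)ᶜ.indicator Z ω ∂μ + ∫⁻ ω, (J T).indicator Z ω ∂μ := by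
          gcongr
          exact mul_le_of_le_one_right' (hexp T)
        _ = ∫⁻ ω, Z ω ∂μ := by
          rw [← lintegral_add_left (hZ2.mono (ℱ.le T) le_rfl)]
          refine lintegral_congr fun ω => ?_
          by_cases h : ω ∈ J T <;> simp [h]
        _ ≤ 1 := hint

open Classical in
/-- Hoeffding's inequality for predictable sampling with a prescribed number of samples. -/
theorem measure_sampled_sum_ge_le {Ω : Type*} {mΩ : MeasurableSpace Ω} {μ : Measure Ω}
    [IsProbabilityMeasure μ] {ℱ : Filtration ℕ mΩ} {Y : ℕ → Ω → ℝ} {J : ℕ → Set Ω}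
    (hY : ∀ s, Measurable[ℱ (s + 1)] (Y s)) (hJ : ∀ s, MeasurableSet[ℱ s] (J s))
    (hind : ∀ s, Indep (MeasurableSpace.comap (Y s) inferInstance) (ℱ s) μ)
    (hexp : ∀ s (r : ℝ), ∫⁻ ω, ENNReal.ofReal (Real.exp (r * Y s ω - r ^ 2 / 8)) ∂μ ≤ 1)
    (T n : ℕ) (hn : 0 < n) {u : ℝ} (hu0 : 0 ≤ u) :
    μ {ω | ((Finset.range T).filter (fun s => ω ∈ J s)).card = n ∧
        u ≤ ∑ s ∈ (Finset.range T).filter (fun s => ω ∈ J s), Y s ω} ≤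
      ENNReal.ofReal (Real.exp (-(2 * u ^ 2 / n))) := by
  have hn' : (0 : ℝ) < n := by exact_mod_cast hn
  set r : ℝ := 4 * u / n with hr
  obtain ⟨hm, hint⟩ := lintegral_prod_sampled_exp_le_one hY hJ hind r (fun s => hexp s r) T
  set Z : Ω → ENNReal := fun ω => ∏ s ∈ Finset.range T,
    if ω ∈ J s then ENNReal.ofReal (Real.exp (r * Y s ω - r ^ 2 / 8)) else 1 with hZ
  have hmark := mul_meas_ge_le_lintegral (μ := μ) (hm.mono (ℱ.le T) le_rfl)
    (ENNReal.ofReal (Real.exp (2 * u ^ 2 / n)))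
  have hsub : {ω | ((Finset.range T).filter (fun s => ω ∈ J s)).card = n ∧
      u ≤ ∑ s ∈ (Finset.range T).filter (fun s => ω ∈ J s), Y s ω} ⊆
      {ω | ENNReal.ofReal (Real.exp (2 * u ^ 2 / n)) ≤ Z ω} := by
    rintro ω ⟨hcard, hu⟩
    simp only [hZ, Set.mem_ofPred_eq]
    rw [← Finset.prod_filter, ← ENNReal.ofReal_prod_of_nonneg (fun _ _ => (Real.exp_pos _).le),
      ← Real.exp_sum, Finset.sum_sub_distrib, ← Finset.mul_sum, Finset.sum_const, hcard,
      nsmul_eq_mul]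
    refine ENNReal.ofReal_le_ofReal (Real.exp_le_exp.mpr ?_)
    have h0 : 0 ≤ r := by positivity
    have h1 : r * u - n * (r ^ 2 / 8) = 2 * u ^ 2 / n := by rw [hr]; field_simp; ring
    have := mul_le_mul_of_nonneg_left hu h0
    linarith
  have hpos := Real.exp_pos (2 * u ^ 2 / n)
  rw [Real.exp_neg, ENNReal.ofReal_inv_of_pos hpos, ENNReal.le_inv_iff_mul_le, mul_comm]
  exact (mul_le_mul_right (measure_mono hsub) _).trans (hmark.trans hint)

/-- Hoeffding's lemma as a bound on the normalised exponential moment. -/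
theorem lintegral_exp_sub_le_one_of_hasSubgaussianMGF {Ω : Type*} {mΩ : MeasurableSpace Ω}
    {μ : Measure Ω} {Y : Ω → ℝ} (h : HasSubgaussianMGF Y ((‖(1 : ℝ) - 0‖₊ / 2) ^ 2) μ) (r : ℝ) :
    ∫⁻ ω, ENNReal.ofReal (Real.exp (r * Y ω - r ^ 2 / 8)) ∂μ ≤ 1 := by
  have hi : Integrable (fun ω => Real.exp (r * Y ω - r ^ 2 / 8)) μ := by
    simp_rw [Real.exp_sub]
    exact (h.integrable_exp_mul r).div_const _
  rw [← ofReal_integral_eq_lintegral_ofReal hi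
    (Filter.Eventually.of_forall fun _ => (Real.exp_pos _).le), ENNReal.ofReal_le_one]
  simp_rw [Real.exp_sub]
  rw [integral_div, div_le_one (Real.exp_pos _)]
  refine (h.mgf_le r).trans_eq ?_
  congr 1
  simp
  ring

theorem filter_observes_obsCount_lt_eq_obsTimes {K : ℕ} (G : SimpleGraph (Fin K))
    (a : ℕ → Fin K) {t T : ℕ} (htT : t ≤ T) (b : Fin K)
    [DecidablePred fun s => Observes G (a s) b ∧ obsCount G a s b < obsCount G a t b] :
    (Finset.range T).filter
      (fun s => Observes G (a s) b ∧ obsCount G a s b < obsCount G a t b) = obsTimes G a t b := by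
  classical
  ext s
  simp only [obsTimes, Finset.mem_filter, Finset.mem_range]
  constructor
  · rintro ⟨-, ho, hc⟩
    refine ⟨?_, ho⟩
    by_contra hst
    refine absurd hc (Finset.card_le_card ?_).not_gt
    exact Finset.filter_subset_filter _ (Finset.range_subset_range.mpr (not_lt.mp hst))
  · rintro ⟨hst, ho⟩
    refine ⟨hst.trans_le htT, ho, Finset.card_lt_card (Finset.ssubset_iff_subset_ne.mpr
      ⟨Finset.filter_subset_filter _ (Finset.range_subset_range.mpr hst.le), fun heq => ?_⟩)⟩
    have : s ∈ obsTimes G a t b := Finset.mem_filter.mpr ⟨Finset.mem_range.mpr hst, ho⟩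
    rw [← heq] at this
    exact lt_irrefl s (Finset.mem_range.mp (Finset.mem_filter.mp this).1)

theorem measurable_obsCount {K : ℕ} {Ω : Type*} {mΩ : MeasurableSpace Ω} (G : SimpleGraph (Fin K))
    {ℱ : Filtration ℕ mΩ} {A : ℕ → Ω → Fin K} (hA : ∀ t, Measurable[ℱ t] (A t)) (t : ℕ)
    (b : Fin K) : Measurable[ℱ t] fun ω => obsCount G (fun s => A s ω) t b := by
  classical
  simp only [obsCount, obsTimes, Finset.card_filter]
  refine Finset.measurable_sum _ fun s hs => ?_
  have hs : ℱ s ≤ ℱ t := ℱ.mono (Finset.mem_range.mp hs).le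
  exact (Measurable.of_discrete (f := fun a : Fin K => if Observes G a b then 1 else 0)).comp
    ((hA s).mono hs le_rfl)

/-- Outside an event of probability at most `2 K T exp (-2 v)`, all empirical means before the
horizon are within `√(v / N)` of the true means. -/
theorem exists_measurableSet_forall_abs_empMean_sub_le {K : ℕ} {Ω : Type*}
    {mΩ : MeasurableSpace Ω} {μ : Measure Ω} [IsProbabilityMeasure μ] (G : SimpleGraph (Fin K))
    {ℱ : Filtration ℕ mΩ} {X : ℕ → Ω → Fin K → ℝ} {A : ℕ → Ω → Fin K} {m : Fin K → ℝ}
    (hX : ∀ t, Measurable[ℱ (t + 1)] (X t)) (hA : ∀ t, Measurable[ℱ t] (A t))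
    (hind : ∀ t, Indep (MeasurableSpace.comap (X t) inferInstance) (ℱ t) μ)
    (hsub : ∀ t b, HasSubgaussianMGF (fun ω => X t ω b - m b) ((‖(1 : ℝ) - 0‖₊ / 2) ^ 2) μ)
    (T : ℕ) {v : ℝ} (hv : 0 ≤ v) :
    ∃ bad : Set Ω, MeasurableSet bad ∧
      μ bad ≤ ENNReal.ofReal (2 * K * T * Real.exp (-(2 * v))) ∧
      ∀ ω ∉ bad, ∀ t < T, ∀ b, obsCount G (fun s => A s ω) t b ≠ 0 →
        |empMean G (fun s => X s ω) (fun s => A s ω) t b - m b| ≤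
          Real.sqrt (v / obsCount G (fun s => A s ω) t b) := by
  classical
  let J : Fin K → ℕ → ℕ → Set Ω := fun b n s =>
    {ω | Observes G (A s ω) b ∧ obsCount G (fun s => A s ω) s b < n}
  let Y : Bool → Fin K → ℕ → Ω → ℝ := fun σ b s ω =>
    if σ then X s ω b - m b else -(X s ω b - m b)
  let D : Bool → Fin K → ℕ → Set Ω := fun σ b n =>
    {ω | ((Finset.range T).filter (fun s => ω ∈ J b n s)).card = n ∧
        Real.sqrt (v * n) ≤ ∑ s ∈ (Finset.range T).filter (fun s => ω ∈ J b n s), Y σ b s ω}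
  have hJ : ∀ b n s, MeasurableSet[ℱ s] (J b n s) := fun b n s => by
    refine MeasurableSet.inter (m := ℱ s) (s₁ := {ω | Observes G (A s ω) b})
      (s₂ := {ω | obsCount G (fun s => A s ω) s b < n}) ?_ ?_
    · exact hA s (MeasurableSet.of_discrete (s := {a : Fin K | Observes G a b}))
    · exact measurable_obsCount G hA s b (MeasurableSet.of_discrete (s := {k : ℕ | k < n}))
  have hYm : ∀ σ b, Measurable fun x : Fin K → ℝ => if σ = true then x b - m b else -(x b - m b) :=
    fun σ b => by cases σ <;> simp <;> fun_prop
  have hD : ∀ σ b n, 0 < n → μ (D σ b n) ≤ ENNReal.ofReal (Real.exp (-(2 * v))) := by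
    intro σ b n hn
    have hn' : (0 : ℝ) < n := by exact_mod_cast hn
    have h := measure_sampled_sum_ge_le (μ := μ) (ℱ := ℱ) (Y := Y σ b) (J := J b n)
      (fun s => (hYm σ b).comp (hX s)) (hJ b n)
      (fun s => indep_of_indep_of_le_left (hind s) (by
        have : Y σ b s = (fun x : Fin K → ℝ => if σ = true then x b - m b else -(x b - m b)) ∘ X s :=
          rfl
        rw [this, ← MeasurableSpace.comap_comp]
        exact MeasurableSpace.comap_mono (hYm σ b).comap_le))
      (fun s r => by
        cases σ
        · exact lintegral_exp_sub_le_one_of_hasSubgaussianMGF (hsub s b).neg r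
        · exact lintegral_exp_sub_le_one_of_hasSubgaussianMGF (hsub s b) r)
      T n hn (Real.sqrt_nonneg (v * n))
    have he : 2 * Real.sqrt (v * n) ^ 2 / n = 2 * v := by
      rw [Real.sq_sqrt (by positivity)]; field_simp
    rw [he] at h
    convert h
  let U : Set Ω := ⋃ p ∈ (Finset.univ : Finset Bool) ×ˢ (Finset.univ : Finset (Fin K)) ×ˢ
    Finset.Icc 1 T, D p.1 p.2.1 p.2.2
  refine ⟨toMeasurable μ U, measurableSet_toMeasurable _ _, ?_, fun ω hω t ht b hN => ?_⟩
  · rw [measure_toMeasurable]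
    refine (measure_biUnion_finset_le _ _).trans ((Finset.sum_le_sum fun p hp =>
      hD p.1 p.2.1 p.2.2 ?_).trans_eq ?_)
    · simp only [Finset.mem_product, Finset.mem_Icc] at hp
      omega
    · rw [Finset.sum_const, ← ENNReal.ofReal_nsmul]
      congr 1
      simp
      ring
  · have hU : ω ∉ U := fun h => hω (subset_toMeasurable _ _ h)
    set n := obsCount G (fun s => A s ω) t b with hn
    have hn0 : (0 : ℝ) < n := by exact_mod_cast Nat.pos_of_ne_zero hN
    have hnT : n ≤ T := by
      refine (Finset.card_filter_le _ _).trans ?_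
      rw [Finset.card_range]; exact ht.le
    have hfil : (Finset.range T).filter (fun s => ω ∈ J b n s) =
        obsTimes G (fun s => A s ω) t b :=
      filter_observes_obsCount_lt_eq_obsTimes G (fun s => A s ω) ht.le b
    have hlt : ∀ σ, ∑ s ∈ obsTimes G (fun s => A s ω) t b, Y σ b s ω < Real.sqrt (v * n) := by
      intro σ
      by_contra hge
      refine hU (Set.mem_biUnion (x := (σ, b, n)) ?_ ?_)
      · simp; omega
      · change _ ∧ _
        rw [hfil]
        exact ⟨rfl, not_lt.mp hge⟩
    have h1 := hlt true
    have h2 := hlt false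
    simp only [Y, if_true, Bool.false_eq_true, if_false, Finset.sum_neg_distrib] at h1 h2
    rw [Finset.sum_sub_distrib, Finset.sum_const, nsmul_eq_mul] at h1 h2
    change _ - (n : ℝ) * m b < _ at h1
    change -(_ - (n : ℝ) * m b) < _ at h2
    have hs : Real.sqrt (v * n) = Real.sqrt (v / n) * n := by
      rw [show v * n = v / n * (n : ℝ) ^ 2 by field_simp, Real.sqrt_mul (by positivity),
        Real.sqrt_sq hn0.le]
    rw [hs] at h1 h2
    have he : empMean G (fun s => X s ω) (fun s => A s ω) t b * n =
        ∑ s ∈ obsTimes G (fun s => A s ω) t b, X s ω b := by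
      rw [empMean, ← hn]; field_simp
    rw [← he] at h1 h2
    rw [abs_le]
    constructor
    · refine le_of_mul_le_mul_right ?_ hn0
      linarith
    · refine le_of_mul_le_mul_right ?_ hn0
      linarith

/-- If all empirical means are within their confidence radius, then an arm with gap `Δ` is pulled
by UCB-N only while it has at most `4 c log (2TK/δ) / Δ²` observations. -/
theorem obsCount_mul_sq_le_of_isUCBNRun {K : ℕ} {G : SimpleGraph (Fin K)} {T : ℕ} {δ c : ℝ}
    {x : ℕ → Fin K → ℝ} {a : ℕ → Fin K} (hrun : IsUCBNRun G T δ c x a) {m : Fin K → ℝ}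
    (hv : 0 ≤ c * Real.log (2 * (T : ℝ) * (K : ℝ) / δ))
    (hgood : ∀ t < T, ∀ b, obsCount G a t b ≠ 0 → |empMean G x a t b - m b| ≤
      Real.sqrt (c * Real.log (2 * (T : ℝ) * (K : ℝ) / δ) / obsCount G a t b))
    {b₀ : Fin K} (hb₀ : ∀ b, m b ≤ m b₀) {t : ℕ} (ht : t < T) :
    (obsCount G a t (a t) : ℝ) * (m b₀ - m (a t)) ^ 2 ≤
      4 * (c * Real.log (2 * (T : ℝ) * (K : ℝ) / δ)) := by
  set v := c * Real.log (2 * (T : ℝ) * (K : ℝ) / δ)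
  by_cases hN : obsCount G a t (a t) = 0
  · rw [hN]; push_cast; linarith
  have hidx := hrun t ht b₀
  by_cases hN₀ : obsCount G a t b₀ = 0
  · simp [ucbIndex, hN, hN₀] at hidx
    exact absurd hidx (EReal.coe_ne_top _)
  simp only [ucbIndex, hN, hN₀, if_false, EReal.coe_le_coe_iff] at hidx
  have h1 := abs_le.mp (hgood t ht (a t) hN)
  have h0 := abs_le.mp (hgood t ht b₀ hN₀)
  have hle : m b₀ - m (a t) ≤ 2 * Real.sqrt (v / obsCount G a t (a t)) := by
    linarith [h1.2, h0.1, hidx]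
  have hnn : 0 ≤ m b₀ - m (a t) := sub_nonneg.mpr (hb₀ _)
  have hn0 : (0 : ℝ) < obsCount G a t (a t) := by exact_mod_cast Nat.pos_of_ne_zero hN
  calc (obsCount G a t (a t) : ℝ) * (m b₀ - m (a t)) ^ 2
      ≤ obsCount G a t (a t) * (2 * Real.sqrt (v / obsCount G a t (a t))) ^ 2 := by gcongr
    _ = 4 * v := by
      rw [mul_pow, Real.sq_sqrt (by positivity)]; field_simp; ring

/-- The expected reward collected in a round is the expected mean of the arm pulled. -/
theorem integral_reward_arm_eq {K : ℕ} {Ω : Type*} {m₀ mΩ : MeasurableSpace Ω} {μ : Measure Ω}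
    [IsProbabilityMeasure μ] {X : Ω → Fin K → ℝ} {A : Ω → Fin K} {m : Fin K → ℝ}
    (hm₀ : m₀ ≤ mΩ) (hA : Measurable[m₀] A)
    (hind : Indep (MeasurableSpace.comap X inferInstance) m₀ μ)
    (hint : ∀ b, Integrable (fun ω => X ω b) μ) (hmean : ∀ b, ∫ ω, X ω b ∂μ = m b) :
    Integrable (fun ω => X ω (A ω)) μ ∧ ∫ ω, X ω (A ω) ∂μ = ∫ ω, m (A ω) ∂μ := by
  classical
  have hA' : Measurable A := hA.mono hm₀ le_rfl
  have hset : ∀ b, MeasurableSet (A ⁻¹' {b}) := fun b => hA' (measurableSet_singleton b)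
  have hX' : (fun ω => X ω (A ω)) =
      fun ω => ∑ b, (A ⁻¹' {b}).indicator (fun _ => (1 : ℝ)) ω * X ω b := by
    ext ω
    rw [Finset.sum_eq_single (A ω)] <;> simp +contextual [Set.indicator, eq_comm]
  have hm' : (fun ω => m (A ω)) =
      fun ω => ∑ b, (A ⁻¹' {b}).indicator (fun _ => (1 : ℝ)) ω * m b := by
    ext ω
    rw [Finset.sum_eq_single (A ω)] <;> simp +contextual [Set.indicator, eq_comm]
  have h1 : ∀ b, Integrable ((A ⁻¹' {b}).indicator fun _ => (1 : ℝ)) μ := fun b =>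
    (integrable_const 1).indicator (hset b)
  have hI : ∀ b, IndepFun ((A ⁻¹' {b}).indicator fun _ => (1 : ℝ)) (fun ω => X ω b) μ := by
    intro b
    have hAX : IndepFun A X μ := by
      rw [IndepFun_iff_Indep]
      exact (indep_of_indep_of_le_right hind hA.comap_le).symm
    have hψ : Measurable fun x : Fin K → ℝ => x b := measurable_pi_apply b
    exact hAX.comp (φ := ({b} : Set (Fin K)).indicator fun _ => (1 : ℝ))
      (ψ := fun x : Fin K → ℝ => x b) Measurable.of_discrete hψ
  have h2 : ∀ b, Integrable (fun ω => (A ⁻¹' {b}).indicator (fun _ => (1 : ℝ)) ω * X ω b) μ :=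
    fun b => (hI b).integrable_mul (h1 b) (hint b)
  rw [hX', hm', integral_finsetSum _ fun b _ => h2 b,
    integral_finsetSum _ fun b _ => (h1 b).mul_const _]
  refine ⟨integrable_finsetSum _ fun b _ => h2 b, Finset.sum_congr rfl fun b _ => ?_⟩
  rw [(hI b).integral_fun_mul_eq_mul_integral (h1 b).aestronglyMeasurable
    (hint b).aestronglyMeasurable, hmean, integral_mul_const]

theorem one_le_indepNum {K : ℕ} (hK : 1 ≤ K) (G : SimpleGraph (Fin K)) : 1 ≤ G.indepNum := by
  have h : G.IsIndepSet (({⟨0, hK⟩} : Finset (Fin K)) : Set (Fin K)) := by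
    rw [Finset.coe_singleton, SimpleGraph.isIndepSet_iff]
    exact Set.pairwise_singleton _ _
  simpa using h.card_le_indepNum

theorem mainTheorem3 {K T : ℕ} (hK : 1 ≤ K) (hT : 1 ≤ T)
    (G : SimpleGraph (Fin K))
    (P : Measure (Fin K → ℝ)) [IsProbabilityMeasure P]
    (hP : ∀ᵐ x ∂P, ∀ a : Fin K, x a ∈ Set.Icc (0 : ℝ) 1)
    {Ω : Type*} {mΩ : MeasurableSpace Ω} (μ : Measure Ω) [IsProbabilityMeasure μ]
    (ℱ : Filtration ℕ mΩ) (X : ℕ → Ω → Fin K → ℝ) (A : ℕ → Ω → Fin K)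
    (hrun : IsStochasticRun μ P ℱ X A)
    (c : ℝ) (hc : c ∈ Set.Icc (1 / 2 : ℝ) 2)
    (hA : ∀ ω, IsUCBNRun G T (1 / (T : ℝ)) c (fun t => X t ω) (fun t => A t ω)) :
    pseudoRegret μ T X A ≤
      2 + 4 * Real.sqrt (2 * (G.indepNum : ℝ) * (T : ℝ) *
        Real.log (2 * (K : ℝ) * (T : ℝ) ^ 2) *
        (Real.logb 2 (G.indepNum : ℝ) + 3)) := by
  have : Nonempty (Fin K) := ⟨⟨0, hK⟩⟩
  have hK1 : (1 : ℝ) ≤ K := by exact_mod_cast hK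
  have hT1 : (1 : ℝ) ≤ T := by exact_mod_cast hT
  have hα1 : (1 : ℝ) ≤ G.indepNum := by exact_mod_cast one_le_indepNum hK G
  have hXm : ∀ t, Measurable (X t) := fun t => (hrun.reward_measurable t).mono (ℱ.le _) le_rfl
  have hAm : ∀ t, Measurable (A t) := fun t => (hrun.arm_measurable t).mono (ℱ.le _) le_rfl
  have hXb : ∀ t b, Measurable fun ω => X t ω b := fun t b => (measurable_pi_apply b).comp (hXm t)
  -- the means of the arms
  set m : Fin K → ℝ := fun b => ∫ x, x b ∂P with hm
  have hPb : ∀ b, ∀ᵐ x ∂P, x b ∈ Set.Icc (0 : ℝ) 1 := fun b => hP.mono fun x hx => hx b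
  have hm0 : ∀ b, 0 ≤ m b := fun b => integral_nonneg_of_ae ((hPb b).mono fun x hx => hx.1)
  have hm1 : ∀ b, m b ≤ 1 := fun b => by
    have hi : Integrable (fun x : Fin K → ℝ => x b) P :=
      Integrable.of_mem_Icc 0 1 (measurable_pi_apply b).aemeasurable (hPb b)
    refine (integral_mono_ae hi (integrable_const (1 : ℝ)) ((hPb b).mono fun x hx => hx.2)).trans ?_
    simp
  have hXI : ∀ t b, ∀ᵐ ω ∂μ, X t ω b ∈ Set.Icc (0 : ℝ) 1 := fun t b =>
    ae_of_ae_map (hXm t).aemeasurable ((hrun.reward_law t).symm ▸ hPb b)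
  have hXint : ∀ t b, Integrable (fun ω => X t ω b) μ := fun t b =>
    Integrable.of_mem_Icc 0 1 (hXb t b).aemeasurable (hXI t b)
  have hmean : ∀ t b, ∫ ω, X t ω b ∂μ = m b := fun t b => by
    rw [hm, ← hrun.reward_law t]
    exact (integral_map (hXm t).aemeasurable
      (measurable_pi_apply b).aestronglyMeasurable).symm
  have hsub : ∀ t b, HasSubgaussianMGF (fun ω => X t ω b - m b) ((‖(1 : ℝ) - 0‖₊ / 2) ^ 2) μ :=
    fun t b => by
      have := hasSubgaussianMGF_of_mem_Icc (hXb t b).aemeasurable (hXI t b)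
      rwa [hmean] at this
  obtain ⟨b₀, hb₀⟩ := Finite.exists_max m
  -- the confidence radius
  set L := Real.log (2 * (K : ℝ) * (T : ℝ) ^ 2) with hL
  have hL2 : Real.log 2 ≤ L := by
    refine Real.log_le_log (by norm_num) ?_
    nlinarith [one_le_pow₀ hT1 (n := 2)]
  have hLpos : 1 / 2 ≤ L := le_trans (by linarith [Real.log_two_gt_d9]) hL2
  have hlog : Real.log (2 * (T : ℝ) * (K : ℝ) / (1 / (T : ℝ))) = L := by
    rw [hL]; congr 1; field_simp
  have hv : 0 ≤ c * L := mul_nonneg (by linarith [hc.1]) (by linarith)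
  obtain ⟨bad, hbadm, hbad, hgood⟩ := exists_measurableSet_forall_abs_empMean_sub_le G
    hrun.reward_measurable hrun.arm_measurable hrun.reward_indep hsub T hv
  have hbadT : T * μ.real bad ≤ 1 := by
    have h1 : μ.real bad ≤ 2 * K * T * Real.exp (-(2 * (c * L))) :=
      ENNReal.toReal_le_of_le_ofReal (by positivity) hbad
    have h2 : Real.exp (-(2 * (c * L))) ≤ (2 * (K : ℝ) * (T : ℝ) ^ 2)⁻¹ := by
      rw [← Real.exp_log (show (0 : ℝ) < 2 * (K : ℝ) * (T : ℝ) ^ 2 by positivity), ← Real.exp_neg]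
      exact Real.exp_le_exp.mpr (by nlinarith [hc.1])
    calc T * μ.real bad ≤ T * (2 * K * T * (2 * (K : ℝ) * (T : ℝ) ^ 2)⁻¹) := by
          gcongr
          exact h1.trans (by gcongr)
      _ = 1 := by field_simp
  -- the regret on the good event
  set R := 2 * Real.sqrt (2 * G.indepNum * (8 * L) * T) with hR
  have hgap1 : ∀ b, m b₀ - m b ≤ 1 := fun b => by linarith [hm0 b, hm1 b₀]
  have hregret : ∀ ω, ∑ t ∈ Finset.range T, (m b₀ - m (A t ω)) ≤
      R + bad.indicator (fun _ => (T : ℝ)) ω := by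
    intro ω
    by_cases hω : ω ∈ bad
    · have : ∑ t ∈ Finset.range T, (m b₀ - m (A t ω)) ≤ T := by
        refine (Finset.sum_le_sum fun t _ => hgap1 (A t ω)).trans_eq ?_
        simp
      rw [Set.indicator_of_mem hω]
      have : 0 ≤ R := by positivity
      linarith
    · rw [Set.indicator_of_notMem hω, add_zero]
      refine sum_gap_le_of_obsCount_le G (fun t => A t ω) T (fun b => m b₀ - m b) hgap1
        (by linarith) fun t ht => ?_
      refine (obsCount_mul_sq_le_of_isUCBNRun (hA ω) (by rwa [hlog]) ?_ hb₀ ht).trans ?_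
      · rw [hlog]; exact hgood ω hω
      · rw [hlog]; nlinarith [hc.2]
  have hmA : ∀ t, Integrable (fun ω => m (A t ω)) μ := fun t =>
    Integrable.of_mem_Icc 0 1 ((Measurable.of_discrete (f := m)).comp (hAm t)).aemeasurable
      (Filter.Eventually.of_forall fun ω => ⟨hm0 _, hm1 _⟩)
  have hgapint : ∀ a t, Integrable (fun ω => m a - m (A t ω)) μ := fun a t =>
    (integrable_const (m a)).sub (hmA t)
  have hbound : ∫ ω, ∑ t ∈ Finset.range T, (m b₀ - m (A t ω)) ∂μ ≤ R + 1 := by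
    have hi : Integrable (bad.indicator fun _ => (T : ℝ)) μ := (integrable_const _).indicator hbadm
    refine (integral_mono (integrable_finsetSum _ fun t _ => hgapint b₀ t)
      (g := fun ω => R + bad.indicator (fun _ => (T : ℝ)) ω)
      ((integrable_const R).add hi) hregret).trans ?_
    rw [integral_add (integrable_const R) hi, integral_indicator_const _ hbadm]
    simp only [integral_const, probReal_univ, smul_eq_mul]
    linarith
  have hRle : R ≤ 4 * Real.sqrt (2 * (G.indepNum : ℝ) * (T : ℝ) * L *
      (Real.logb 2 (G.indepNum : ℝ) + 3)) := by
    have hlogb : 0 ≤ Real.logb 2 (G.indepNum : ℝ) := Real.logb_nonneg (by norm_num) hα1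
    have h4 : 2 * G.indepNum * (8 * L) * T ≤ 2 ^ 2 * (2 * (G.indepNum : ℝ) * (T : ℝ) * L *
        (Real.logb 2 (G.indepNum : ℝ) + 3)) := by
      have : 0 ≤ (G.indepNum : ℝ) * T * L := by positivity
      nlinarith [mul_nonneg this hlogb]
    rw [hR]
    have h5 := Real.sqrt_le_sqrt h4
    rw [Real.sqrt_mul (x := 2 ^ 2) (by norm_num), Real.sqrt_sq (by norm_num)] at h5
    linarith
  refine ciSup_le fun a => ?_
  have hpull := fun t => integral_reward_arm_eq (ℱ.le t) (hrun.arm_measurable t)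
    (hrun.reward_indep t) (hXint t) (hmean t)
  have heq : ∫ ω, (∑ t ∈ Finset.range T, X t ω a - ∑ t ∈ Finset.range T, X t ω (A t ω)) ∂μ =
      ∫ ω, ∑ t ∈ Finset.range T, (m a - m (A t ω)) ∂μ := by
    have hdiff : ∀ t, Integrable (fun ω => X t ω a - X t ω (A t ω)) μ := fun t =>
      (hXint t a).sub (hpull t).1
    simp_rw [← Finset.sum_sub_distrib]
    rw [integral_finsetSum _ fun t _ => hdiff t, integral_finsetSum _ fun t _ => hgapint a t]
    refine Finset.sum_congr rfl fun t _ => ?_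
    rw [integral_sub (hXint t a) (hpull t).1, integral_sub (integrable_const _) (hmA t), hmean,
      (hpull t).2]
    simp
  rw [heq]
  refine (integral_mono (integrable_finsetSum _ fun t _ => hgapint a t)
    (integrable_finsetSum _ fun t _ => hgapint b₀ t)
    fun ω => Finset.sum_le_sum fun t _ => sub_le_sub_right (hb₀ a) _).trans ?_
  linarith
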